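/- Let $p$ be a prime, let $\mathbb F_q$ be a finite field of characteristic $p$ with $q$ elements, and let $I_i$ be the set of monic irreducible polynomials of degree $i$ over $\mathbb F_q$. Let $T\subset\mathbb N$ be a finite set with $p\nmid i$ for every $i\in T$, let $m\ge 0$ and $l_i\ge 0$ $(i\in T)$ be integers, and let $\alpha\in\mathbb F_q$. For a monic polynomial $f=x^{d}+f_1x^{d-1}+\cdots+f_d$ put $\langle f\rangle = x^{d}f(1/x) \bmod x^2 = 1+f_1x \bmod x^2$ (with $f_1=0$ if $d=0$). Let $N^*(m,\prod_{i\in T}I_i^{l_i},\langle x+\alpha\rangle)$ be the number of monic polynomials $g$ over $\mathbb F_q$ of degree $m$ with $\langle g\rangle=\langle x+\alpha\rangle$ that have, for each $i\in T$, exactly $l_i$ monic irreducible factors of degree $i$ counted with multiplicity. Write $[P]=1$ if $P$ is true and $[P]=0$ otherwise, let $v(\alpha)=q[\alpha=0]-1$, and let $$M=q^{m-1}\Big(\prod_{i\in T}\binom{|I_i|+l_i-1}{l_i}q^{-il_i}\Big)\sum_{(j_i)_{i\in T},\ 0\le j_i\le |I_i|}\Big(\prod_{i\in T}\binom{|I_i|}{j_i}(-1)^{j_i}q^{-ij_i}\Big)\Big[\sum_{i\in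 T} i(l_i+j_i)\le m\Big].$$ If $p\nmid m$ or $p\nmid l_i$ for some $i\in T$, then $$N^*\Big(m,\prod_{i\in T}I_i^{l_i},\langle x+\alpha\rangle\Big)=M.$$ If $p\mid m$ and $p\mid l_i$ for every $i\in T$, then $$N^*\Big(m,\prod_{i\in T}I_i^{l_i},\langle x+\alpha\rangle\Big)=M+\frac{v(\alpha)}{q}\Big(\prod_{i\in T}\binom{|I_i|/p+l_i/p-1}{l_i/p}\Big)\sum_{(k_i)_{i\in T},\ 0\le k_i\le |I_i|/p}\Big(\prod_{i\in T}\binom{|I_i|/p}{k_i}(-1)^{k_i}\Big)\Big[\sum_{i\in T} i\Big(\frac{l_i}{p}+k_i\Big)=\frac mp\Big].$$ -/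

import Mathlib

open Polynomial

noncomputable section

/-- The class `⟨f⟩_w = x^{d(f)} f(1/x) mod x^{w+1}` of a polynomial `f`. For
`f = x^d + f₁ x^{d-1} + ⋯ + f_d` this is `1 + f₁ x + ⋯ + f_w x^w mod x^{w+1}`,
where `f_j = 0` for `j > d`. -/
def coeffClass {F : Type*} [Field F] (w : ℕ) (f : F[X]) :
    F[X] ⧸ Ideal.span {(X : F[X]) ^ (w + 1)} :=
  Ideal.Quotient.mk (Ideal.span {(X : F[X]) ^ (w + 1)}) f.reverse

/-- The set `I_i` of monic irreducible polynomials of degree `i` over `F`. -/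
def monicIrred (F : Type*) [Field F] (i : ℕ) : Set F[X] :=
  {g | g.Monic ∧ Irreducible g ∧ g.natDegree = i}

/-- The number `|I_i|` (over a finite field the set `I_i` is finite). -/
def numIrred (F : Type*) [Field F] (i : ℕ) : ℕ := (monicIrred F i).ncard

/-- The number of monic irreducible factors of `f` of degree `i`, counted with multiplicity:
the sum over `g ∈ I_i` of the largest `k` with `g ^ k ∣ f`. -/
def numFactors {F : Type*} [Field F] (i : ℕ) (f : F[X]) : ℕ :=
  ∑ᶠ g ∈ monicIrred F i, multiplicity g f

/-- `N*(m, ∏_{i ∈ T} I_i^{l_i}, ⟨f⟩_w)`: the number of monic polynomials `g` of degree `m` with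
`⟨g⟩_w = ⟨f⟩_w` that have, for each `i ∈ T`, exactly `l i` monic irreducible factors of degree `i`
counted with multiplicity. -/
def NStar {F : Type*} [Field F] (w m : ℕ) (T : Finset ℕ) (l : ℕ → ℕ) (f : F[X]) : ℕ :=
  {g : F[X] | g.Monic ∧ g.natDegree = m ∧ coeffClass w g = coeffClass w f ∧
    ∀ i ∈ T, numFactors i g = l i}.ncard

/-- The main term
`q^{m-1} ∏_{i ∈ T} C(|I_i| + l_i - 1, l_i) q^{-i l_i}
  · ∑_{(j_i)} ∏_{i ∈ T} C(|I_i|, j_i) (-1)^{j_i} q^{-i j_i} [∑_{i ∈ T} i (l_i + j_i) ≤ m]`,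
the sum running over all tuples `(j_i)_{i ∈ T}` with `0 ≤ j_i ≤ |I_i|`. -/
def mainTerm (F : Type*) [Field F] (m : ℕ) (T : Finset ℕ) (l : ℕ → ℕ) : ℚ :=
  (Nat.card F : ℚ) ^ ((m : ℤ) - 1) *
    (∏ i ∈ T, ((numIrred F i + l i - 1).choose (l i) : ℚ) *
      (Nat.card F : ℚ) ^ (-((i * l i : ℕ) : ℤ))) *
    ∑ j ∈ Fintype.piFinset (fun i : T => Finset.range (numIrred F i + 1)),
      if ∑ i : T, (i : ℕ) * (l i + j i) ≤ m then
        ∏ i : T, ((numIrred F i).choose (j i) : ℚ) * (-1) ^ (j i) *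
          (Nat.card F : ℚ) ^ (-(((i : ℕ) * j i : ℕ) : ℤ))
      else 0

open Classical in
/-- `v(α) = q [α = 0] - 1`. -/
def vCoeff {F : Type*} [Field F] (α : F) : ℚ :=
  (Nat.card F : ℚ) * (if α = 0 then 1 else 0) - 1

/-- The secondary term
`(v(α)/q) ∏_{i ∈ T} C(|I_i|/p + l_i/p - 1, l_i/p)
  · ∑_{(k_i)} ∏_{i ∈ T} C(|I_i|/p, k_i) (-1)^{k_i} [∑_{i ∈ T} i (l_i/p + k_i) = m/p]`,
the sum running over all tuples `(k_i)_{i ∈ T}` with `0 ≤ k_i ≤ |I_i|/p`. It is used when `p`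
divides `m` and every `l_i` but no `i ∈ T`; then `p` also divides every `|I_i|`, which is
positive, so that all the divisions are exact. -/
def secondTerm {F : Type*} [Field F] (p m : ℕ) (T : Finset ℕ) (l : ℕ → ℕ) (α : F) : ℚ :=
  vCoeff α / (Nat.card F : ℚ) *
    (∏ i ∈ T, ((numIrred F i / p + l i / p - 1).choose (l i / p) : ℚ)) *
    ∑ k ∈ Fintype.piFinset (fun i : T => Finset.range (numIrred F i / p + 1)),
      if ∑ i : T, (i : ℕ) * (l i / p + k i) = m / p then
        ∏ i : T, ((numIrred F i / p).choose (k i) : ℚ) * (-1) ^ (k i)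
      else 0

end

/-! ### Generating series of multiplicative weights and removal of Euler factors. -/

section MonicSeries

variable {F : Type*} [Field F]

/-! The condition on `⟨g⟩` only fixes `g₁`, so it is detected by the additive characters `ψ` of the
field: `q N*` is the sum over `ψ` of `ψ(-α) S(ψ)`, where `S(ψ)` sums `ψ(g₁)` over the admissible `g`
(`card_mul_NStar`). The weight `ψ(g₁)` is completely multiplicative. Hence prescribing the number of
factors of degree `i` replaces the Euler factors at `I_i` by a single term in `X ^ (i * l i)`
(`monicSeries_forall_sum_multiplicity_eq`).

For trivial `ψ` the full series is `1/(1 - qX)`, which yields `M`. For `ψ ≠ 0` the full series is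
`1`. The translations `x ↦ x + b` permute `I_i` and shift `P₁` by `i b`; since `p ∤ i`, the values
`ψ(P₁)` are equidistributed over the `p`-th roots of unity, and `∏ (1 - ψ(P₁) Y) = (1 -
Y^p)^(|I_i|/p)` (`prod_irredFinset_one_sub`). So `S(ψ)` is the same for all `ψ ≠ 0` and vanishes
unless `p` divides `m` and every `l i`; its total weight is `∑_{ψ ≠ 0} ψ(-α) = v(α)`. -/

theorem multiplicity_mul_self {P h : F[X]} (hP : Irreducible P) (hh : h ≠ 0) :
    multiplicity P (P * h) = multiplicity P h + 1 := by
  have hfin : FiniteMultiplicity P (P * h) :=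
    FiniteMultiplicity.of_prime_left hP.prime (mul_ne_zero hP.ne_zero hh)
  rw [multiplicity_mul hP.prime hfin, multiplicity_self, add_comm]

theorem multiplicity_mul_of_ne {P Q h : F[X]} (hPm : P.Monic) (hQm : Q.Monic)
    (hP : Irreducible P) (hQ : Irreducible Q) (hPQ : Q ≠ P) (hh : h ≠ 0) :
    multiplicity Q (P * h) = multiplicity Q h := by
  have hfin : FiniteMultiplicity Q (P * h) :=
    FiniteMultiplicity.of_prime_left hQ.prime (mul_ne_zero hP.ne_zero hh)
  rw [multiplicity_mul hQ.prime hfin, multiplicity_eq_zero.2, zero_add]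
  intro hd
  exact hPQ (eq_of_monic_of_associated hQm hPm (hQ.associated_of_dvd hP hd))

theorem finite_monic_natDegree_eq (F : Type*) [Field F] [Finite F] (m : ℕ) :
    {g : F[X] | g.Monic ∧ g.natDegree = m}.Finite := by
  have : Finite (degreeLT F (m + 1)) :=
    Finite.of_equiv _ (degreeLTEquiv F (m + 1)).symm.toEquiv
  refine (Set.toFinite (degreeLT F (m + 1) : Set F[X])).subset ?_
  rintro g ⟨-, hg⟩
  rw [SetLike.mem_coe, mem_degreeLT]
  exact degree_le_natDegree.trans_lt (by rw [hg]; exact_mod_cast Nat.lt_succ_self m)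

/-- The finite set of monic polynomials of degree `m` over a finite field. -/
noncomputable def monicFinset (F : Type*) [Field F] [Finite F] (m : ℕ) : Finset F[X] :=
  (finite_monic_natDegree_eq F m).toFinset

/-- The generating series `∑ w(g) X ^ deg g` over the monic polynomials `g`. -/
noncomputable def monicSeries [Finite F] (w : F[X] → ℂ) : PowerSeries ℂ :=
  PowerSeries.mk fun m => ∑ g ∈ monicFinset F m, w g

variable [Finite F]

@[simp]
theorem mem_monicFinset {m : ℕ} {g : F[X]} :
    g ∈ monicFinset F m ↔ g.Monic ∧ g.natDegree = m := by
  simp [monicFinset]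

theorem monicSeries_congr {w w' : F[X] → ℂ} (h : ∀ g : F[X], g.Monic → w g = w' g) :
    monicSeries w = monicSeries w' := by
  ext m
  simp only [monicSeries, PowerSeries.coeff_mk]
  exact Finset.sum_congr rfl fun g hg => h g (mem_monicFinset.1 hg).1

theorem monicSeries_add (w w' : F[X] → ℂ) :
    monicSeries (fun g => w g + w' g) = monicSeries w + monicSeries w' := by
  ext m
  simp [monicSeries, Finset.sum_add_distrib]

theorem monicSeries_const_mul (a : ℂ) (w : F[X] → ℂ) :
    monicSeries (fun g => a * w g) = PowerSeries.C a * monicSeries w := by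
  ext m
  simp [monicSeries, Finset.mul_sum]

open Classical in
theorem monicSeries_ite_dvd {P : F[X]} (hP : P.Monic) (w : F[X] → ℂ) :
    monicSeries (fun g => if P ∣ g then w g else 0) =
      PowerSeries.X ^ P.natDegree * monicSeries (fun h => w (P * h)) := by
  ext m
  rw [PowerSeries.coeff_X_pow_mul']
  simp only [monicSeries, PowerSeries.coeff_mk]
  rw [← Finset.sum_filter]
  split_ifs with h
  · symm
    refine Finset.sum_bij (fun k _ => P * k) ?_ ?_ ?_ ?_
    · intro k hk
      obtain ⟨h1, h2⟩ := mem_monicFinset.1 hk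
      simp only [Finset.mem_filter, mem_monicFinset, dvd_mul_right, and_true]
      refine ⟨hP.mul h1, ?_⟩
      rw [hP.natDegree_mul h1]; omega
    · intro a _ b _ hab
      exact mul_left_cancel₀ hP.ne_zero hab
    · intro g hg
      simp only [Finset.mem_filter, mem_monicFinset] at hg
      obtain ⟨⟨h1, h2⟩, k, rfl⟩ := hg
      have hk : k.Monic := hP.of_mul_monic_left h1
      rw [hP.natDegree_mul hk] at h2
      exact ⟨k, mem_monicFinset.2 ⟨hk, by omega⟩, rfl⟩
    · intros; rfl
  · refine Finset.sum_eq_zero fun g hg => ?_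
    simp only [Finset.mem_filter, mem_monicFinset] at hg
    obtain ⟨⟨h1, h2⟩, h3⟩ := hg
    exact absurd (h2 ▸ natDegree_le_of_dvd h3 h1.ne_zero) h

open Classical in
theorem monicSeries_ite_not_dvd {P : F[X]} (hP : P.Monic) {a : ℂ} {w : F[X] → ℂ}
    (hw : ∀ h : F[X], h.Monic → w (P * h) = a * w h) :
    monicSeries (fun g => if P ∣ g then 0 else w g) =
      (1 - PowerSeries.C a * PowerSeries.X ^ P.natDegree) * monicSeries w := by
  have h1 := monicSeries_add (fun g => if P ∣ g then w g else 0)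
    (fun g => if P ∣ g then 0 else w g)
  rw [monicSeries_ite_dvd hP, monicSeries_congr hw, monicSeries_const_mul] at h1
  have h2 : monicSeries w = monicSeries
      (fun g => (if P ∣ g then w g else 0) + (if P ∣ g then 0 else w g)) :=
    monicSeries_congr fun g _ => by split_ifs <;> simp
  rw [← h2] at h1
  linear_combination -h1

-- Dividing by the Euler factors at `A` and reinserting the part of multiplicity `l`, without
-- infinite products: adjoin one `P` at a time and, for each `P`, induct on `l`.
open Classical in
theorem monicSeries_sum_multiplicity_eq (i : ℕ) (a : F[X] → ℂ) (A : Finset F[X])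
    (hA : ∀ P ∈ A, P.Monic ∧ Irreducible P ∧ P.natDegree = i) (w : F[X] → ℂ)
    (hw : ∀ P ∈ A, ∀ h : F[X], h.Monic → w (P * h) = a P * w h) (l : ℕ) :
    monicSeries (fun g => if ∑ P ∈ A, multiplicity P g = l then w g else 0) =
      PowerSeries.C (PowerSeries.coeff l (∏ P ∈ A, PowerSeries.mk fun n => a P ^ n)) *
        PowerSeries.X ^ (i * l) *
        (∏ P ∈ A, (1 - PowerSeries.C (a P) * PowerSeries.X ^ i)) * monicSeries w := by
  induction A using Finset.induction_on generalizing l with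
  | empty =>
    rcases l with _ | l
    · simp
    · have : monicSeries (F := F) (fun _ => 0) = 0 := by ext; simp [monicSeries]
      simp [PowerSeries.coeff_one, this]
  | insert P A hPA ih =>
    obtain ⟨hPm, hPi, rfl⟩ := hA P (Finset.mem_insert_self _ _)
    have ih' := ih (fun Q hQ => hA Q (Finset.mem_insert_of_mem hQ))
      (fun Q hQ => hw Q (Finset.mem_insert_of_mem hQ))
    have hvA : ∀ h : F[X], h.Monic →
        ∑ Q ∈ A, multiplicity Q (P * h) = ∑ Q ∈ A, multiplicity Q h := fun h hh =>
      Finset.sum_congr rfl fun Q hQ => by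
        obtain ⟨hQm, hQi, -⟩ := hA Q (Finset.mem_insert_of_mem hQ)
        exact multiplicity_mul_of_ne hPm hQm hPi hQi (fun h => hPA (h ▸ hQ)) hh.ne_zero
    have hwP := hw P (Finset.mem_insert_self _ _)
    set G : PowerSeries ℂ := ∏ Q ∈ A, PowerSeries.mk fun n => a Q ^ n with hG
    have hE : (PowerSeries.mk fun n => a P ^ n) =
        1 + PowerSeries.C (a P) * (PowerSeries.X * PowerSeries.mk fun n => a P ^ n) := by
      ext (_ | n)
      · simp
      · simp [PowerSeries.coeff_one, PowerSeries.coeff_succ_X_mul, pow_succ']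
    -- Either `P ∤ g`, and only the factors from `A` count, or `g = P * h`, where `h` has one factor
    -- fewer.
    have key : ∀ l : ℕ, monicSeries
        (fun g => if ∑ Q ∈ insert P A, multiplicity Q g = l then w g else 0) =
        (1 - PowerSeries.C (a P) * PowerSeries.X ^ P.natDegree) *
          monicSeries (fun g => if ∑ Q ∈ A, multiplicity Q g = l then w g else 0) +
        PowerSeries.X ^ P.natDegree * (PowerSeries.C (a P) * monicSeries
          (fun g => if ∑ Q ∈ insert P A, multiplicity Q g + 1 = l then w g else 0)) := by
      intro l
      rw [← monicSeries_const_mul, ← monicSeries_ite_not_dvd hPm (a := a P)]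
      · rw [monicSeries_congr (w := fun g =>
          a P * if ∑ Q ∈ insert P A, multiplicity Q g + 1 = l then w g else 0)
          (w' := fun h => (fun g => if ∑ Q ∈ insert P A, multiplicity Q g = l then w g else 0)
            (P * h)), ← monicSeries_ite_dvd hPm
          (fun g => if ∑ Q ∈ insert P A, multiplicity Q g = l then w g else 0), ← monicSeries_add]
        · refine monicSeries_congr fun g _ => ?_
          by_cases hd : P ∣ g
          · simp [hd]
          · simp [hd, Finset.sum_insert hPA, multiplicity_eq_zero.2 hd]
        · intro h hh
          simp only [Finset.sum_insert hPA, hvA h hh, multiplicity_mul_self hPi hh.ne_zero,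
            hwP h hh, mul_ite, mul_zero, add_right_comm]
      · intro h hh
        simp only [hvA h hh, hwP h hh, mul_ite, mul_zero]
    rw [Finset.prod_insert hPA, Finset.prod_insert hPA, ← hG]
    induction l with
    | zero =>
      rw [key, ih']
      have h0 : monicSeries (fun g =>
          if ∑ Q ∈ insert P A, multiplicity Q g + 1 = 0 then w g else 0) = 0 := by
        ext; simp [monicSeries]
      rw [h0]
      have hc : PowerSeries.coeff 0 ((PowerSeries.mk fun n => a P ^ n) * G) =
          PowerSeries.coeff 0 G := by
        rw [PowerSeries.coeff_mul]
        simp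
      rw [hc]
      ring
    | succ k ihk =>
      rw [key, ih']
      simp only [Nat.add_right_cancel_iff]
      rw [ihk]
      have hc : PowerSeries.coeff (k + 1) ((PowerSeries.mk fun n => a P ^ n) * G) =
          PowerSeries.coeff (k + 1) G +
            a P * PowerSeries.coeff k ((PowerSeries.mk fun n => a P ^ n) * G) := by
        conv_lhs => rw [hE]
        rw [add_mul, one_mul, map_add, mul_assoc, mul_assoc, PowerSeries.coeff_C_mul,
          PowerSeries.coeff_succ_X_mul]
      rw [hc, map_add, map_mul PowerSeries.C]
      ring

open Classical in
theorem monicSeries_forall_sum_multiplicity_eq (I : ℕ → Finset F[X])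
    (hI : ∀ i, ∀ P ∈ I i, P.Monic ∧ Irreducible P ∧ P.natDegree = i) (w : F[X] → ℂ)
    (hw : ∀ P h : F[X], P.Monic → h.Monic → w (P * h) = w P * w h) (l : ℕ → ℕ) (T : Finset ℕ) :
    monicSeries (fun g => if ∀ i ∈ T, ∑ P ∈ I i, multiplicity P g = l i then w g else 0) =
      (∏ i ∈ T, (PowerSeries.C
          (PowerSeries.coeff (l i) (∏ P ∈ I i, PowerSeries.mk fun n => w P ^ n)) *
        PowerSeries.X ^ (i * l i) *
        (∏ P ∈ I i, (1 - PowerSeries.C (w P) * PowerSeries.X ^ i)))) * monicSeries w := by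
  induction T using Finset.induction_on with
  | empty => simp
  | insert j T hj ih =>
    rw [Finset.prod_insert hj, mul_assoc, ← ih, ← monicSeries_sum_multiplicity_eq j w (I j) (hI j)]
    · refine monicSeries_congr fun g _ => ?_
      simp only [Finset.forall_mem_insert, ite_and]
    · intro P hP h hh
      obtain ⟨hPm, hPi, hPj⟩ := hI j P hP
      have : ∀ i ∈ T, ∑ Q ∈ I i, multiplicity Q (P * h) = ∑ Q ∈ I i, multiplicity Q h := by
        intro i hi
        refine Finset.sum_congr rfl fun Q hQ => ?_
        obtain ⟨hQm, hQi, hQj⟩ := hI i Q hQ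
        refine multiplicity_mul_of_ne hPm hQm hPi hQi ?_ hh.ne_zero
        rintro rfl
        exact hj (hPj ▸ hQj ▸ hi)
      have h2 : (∀ i ∈ T, ∑ Q ∈ I i, multiplicity Q (P * h) = l i) ↔
          (∀ i ∈ T, ∑ Q ∈ I i, multiplicity Q h = l i) :=
        forall₂_congr fun i hi => by rw [this i hi]
      simp only [h2, hw P h hPm hh, mul_ite, mul_zero]

end MonicSeries

/-! ### Inverses and `p`-th roots of power series. -/

section PowerSeriesIdentities

theorem mk_pow_mul_one_sub_C_mul_X (a : ℂ) :
    (PowerSeries.mk fun n => a ^ n) * (1 - PowerSeries.C a * PowerSeries.X) = 1 := by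
  rw [mul_sub, mul_one, ← mul_assoc, mul_comm _ (PowerSeries.C a), mul_assoc]
  ext (_ | n)
  · simp
  · simp [PowerSeries.coeff_one, PowerSeries.coeff_succ_mul_X, pow_succ']

theorem mk_choose_mul_one_sub_X_pow (n : ℕ) :
    (PowerSeries.mk fun l => ((n + l - 1).choose l : ℂ)) * (1 - PowerSeries.X) ^ n = 1 := by
  have h : (PowerSeries.mk fun l => ((n + l - 1).choose l : ℂ)) =
      (PowerSeries.invOneSubPow ℂ n).val := by
    rcases n with _ | n
    · rw [PowerSeries.invOneSubPow_zero]
      ext (_ | l) <;> simp [PowerSeries.coeff_one]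
    · rw [PowerSeries.invOneSubPow_val_succ_eq_mk_add_choose]
      ext l
      rw [PowerSeries.coeff_mk, PowerSeries.coeff_mk, show n + 1 + l - 1 = n + l by omega,
        Nat.choose_symm_add]
  rw [h, ← PowerSeries.invOneSubPow_inv_eq_one_sub_pow]
  exact (PowerSeries.invOneSubPow ℂ n).val_inv

theorem mk_ite_choose_mul_one_sub_X_pow_pow {p : ℕ} (hp : p ≠ 0) (n : ℕ) :
    (PowerSeries.mk fun l => if p ∣ l then ((n + l / p - 1).choose (l / p) : ℂ) else 0) *
      (1 - PowerSeries.X ^ p) ^ n = 1 := by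
  have h := congrArg (PowerSeries.expand p hp) (mk_choose_mul_one_sub_X_pow n)
  rw [map_mul, map_pow, map_sub, map_one, PowerSeries.expand_X] at h
  convert h using 2
  ext l
  simp [PowerSeries.coeff_expand]

theorem coeff_prod_mk_pow_eq {ι : Type*} (A : Finset ι) (a : ι → ℂ) (c : ℕ → ℂ)
    (h : PowerSeries.mk c * ∏ P ∈ A, (1 - PowerSeries.C (a P) * PowerSeries.X) = 1) (l : ℕ) :
    PowerSeries.coeff l (∏ P ∈ A, PowerSeries.mk fun n => a P ^ n) = c l := by
  have h1 : (∏ P ∈ A, PowerSeries.mk fun n => a P ^ n) *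
      ∏ P ∈ A, (1 - PowerSeries.C (a P) * PowerSeries.X) = 1 := by
    rw [← Finset.prod_mul_distrib]
    exact Finset.prod_eq_one fun P _ => mk_pow_mul_one_sub_C_mul_X (a P)
  rw [mul_comm] at h
  rw [left_inv_eq_right_inv h1 h, PowerSeries.coeff_mk]

/-- The cofactor of `f - g` in `f ^ p - g ^ p` has constant coefficient `p ≠ 0`. -/
theorem eq_of_pow_eq_pow_of_constantCoeff_eq_one {p : ℕ} (hp : p ≠ 0) {f g : PowerSeries ℂ}
    (hf : PowerSeries.constantCoeff f = 1) (hg : PowerSeries.constantCoeff g = 1)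
    (h : f ^ p = g ^ p) : f = g := by
  have h1 := geom_sum₂_mul f g p
  rw [h, sub_self, mul_eq_zero] at h1
  rcases h1 with h1 | h1
  · have := congrArg PowerSeries.constantCoeff h1
    simp [hf, hg, hp] at this
  · exact sub_eq_zero.1 h1

end PowerSeriesIdentities

/-! ### Translations acting on irreducible polynomials. -/

section Translation

variable {F : Type*} [Field F]

theorem nextCoeff_taylor (b : F) (f : F[X]) :
    (taylor b f).nextCoeff = f.nextCoeff + f.natDegree * f.leadingCoeff * b := by
  rcases Nat.eq_zero_or_pos f.natDegree with h | h
  · simp [nextCoeff, natDegree_taylor, h]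
  · obtain ⟨d, hd⟩ : ∃ d, f.natDegree = d + 1 := ⟨f.natDegree - 1, by omega⟩
    rw [nextCoeff_of_natDegree_pos h, nextCoeff_of_natDegree_pos (by rwa [natDegree_taylor]),
      natDegree_taylor, taylor_coeff, leadingCoeff, hd, Nat.add_sub_cancel,
      -- The `d`-th Hasse derivative of a polynomial of degree `d + 1` has degree at most `1`.
      eval_eq_sum_range' (n := 2)]
    · simp [Finset.sum_range_succ, hasseDeriv_coeff, add_comm 1 d]
    · have := natDegree_hasseDeriv_le f d
      omega

variable [Finite F]

open Classical in
/-- The finite set of monic irreducible polynomials of degree `i` over a finite field. -/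
noncomputable def irredFinset (F : Type*) [Field F] [Finite F] (i : ℕ) : Finset F[X] :=
  (monicFinset F i).filter Irreducible

theorem mem_irredFinset {i : ℕ} {P : F[X]} :
    P ∈ irredFinset F i ↔ P.Monic ∧ Irreducible P ∧ P.natDegree = i := by
  classical
  simp only [irredFinset, Finset.mem_filter, mem_monicFinset]
  tauto

theorem coe_irredFinset (i : ℕ) : (irredFinset F i : Set F[X]) = monicIrred F i := by
  ext P
  simp [mem_irredFinset, monicIrred]

theorem card_irredFinset (i : ℕ) : (irredFinset F i).card = numIrred F i := by
  rw [numIrred, ← coe_irredFinset, Set.ncard_coe_finset]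

theorem numFactors_eq_sum (i : ℕ) (g : F[X]) :
    numFactors i g = ∑ P ∈ irredFinset F i, multiplicity P g := by
  rw [numFactors, ← coe_irredFinset, finsum_mem_coe_finset]

theorem taylor_mem_irredFinset (b : F) {i : ℕ} {P : F[X]} (h : P ∈ irredFinset F i) :
    taylor b P ∈ irredFinset F i := by
  obtain ⟨h1, h2, h3⟩ := mem_irredFinset.1 h
  refine mem_irredFinset.2 ⟨?_, ?_, ?_⟩
  · rw [Monic, leadingCoeff_taylor, h1.leadingCoeff]
  · exact (MulEquiv.irreducible_iff (taylorEquiv b)).2 h2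
  · rw [natDegree_taylor, h3]

theorem nextCoeff_taylor_of_mem_irredFinset (b : F) {i : ℕ} {P : F[X]}
    (h : P ∈ irredFinset F i) : (taylor b P).nextCoeff = P.nextCoeff + i * b := by
  obtain ⟨h1, -, h3⟩ := mem_irredFinset.1 h
  rw [nextCoeff_taylor, h1.leadingCoeff, h3, mul_one]

theorem prod_irredFinset_taylor {M : Type*} [CommMonoid M] (b : F) (i : ℕ) (φ : F → M) :
    ∏ P ∈ irredFinset F i, φ (P.nextCoeff + i * b) = ∏ P ∈ irredFinset F i, φ P.nextCoeff := by
  refine Finset.prod_bij (fun P _ => taylor b P) (fun P hP => taylor_mem_irredFinset b hP)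
    (fun P _ Q _ h => taylor_injective b h) (fun P hP => ?_) (fun P hP => ?_)
  · refine ⟨taylor (-b) P, taylor_mem_irredFinset _ hP, ?_⟩
    rw [taylor_taylor, add_neg_cancel, taylor_zero]
  · rw [nextCoeff_taylor_of_mem_irredFinset b hP]

variable (p : ℕ) [CharP F p]

/-- Translation by `(d - c) / i` carries the fibre `P₁ = c` into the fibre `P₁ = d`, so all `q`
fibres have the same size. -/
theorem dvd_numIrred {i : ℕ} (hi : ¬ p ∣ i) : p ∣ numIrred F i := by
  classical
  have := Fintype.ofFinite F
  have hi0 : (i : F) ≠ 0 := fun h => hi ((CharP.cast_eq_zero_iff F p i).1 h)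
  have hle : ∀ c d : F, ((irredFinset F i).filter fun P => P.nextCoeff = c).card ≤
      ((irredFinset F i).filter fun P => P.nextCoeff = d).card := by
    intro c d
    refine Finset.card_le_card_of_injOn (taylor ((d - c) / i)) ?_
      (fun P _ Q _ h => taylor_injective _ h)
    intro P hP
    simp only [Finset.coe_filter, Set.mem_ofPred_eq] at hP ⊢
    refine ⟨taylor_mem_irredFinset _ hP.1, ?_⟩
    rw [nextCoeff_taylor_of_mem_irredFinset _ hP.1, hP.2]
    field_simp
    ring
  rw [← card_irredFinset, Finset.card_eq_sum_card_fiberwise (f := nextCoeff) (t := Finset.univ)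
    (fun _ _ => Finset.mem_coe.2 (Finset.mem_univ _)),
    Finset.sum_congr rfl fun c _ => le_antisymm (hle c 0) (hle 0 c), Finset.sum_const,
    smul_eq_mul, Finset.card_univ]
  obtain ⟨n, -, hn⟩ := FiniteField.card F p
  rw [hn]
  exact Dvd.dvd.mul_right (dvd_pow_self p n.pos.ne') _

/-- Translation invariance lets `Y` be multiplied by any `p`-th root of unity `μ`. The `p`-th power
of the product is therefore the product over all `μ`, and `∏_μ (1 - μ z) = 1 - z^p`. Constant
coefficient `1` makes the `p`-th root unique. -/
theorem prod_irredFinset_one_sub (hp : p.Prime) {i : ℕ} (hi : ¬ p ∣ i) {ψ : AddChar F ℂ}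
    (hψ : ψ ≠ 0) {Y : PowerSeries ℂ} (hY : PowerSeries.constantCoeff Y = 0) :
    ∏ P ∈ irredFinset F i, (1 - PowerSeries.C (ψ P.nextCoeff) * Y) =
      (1 - Y ^ p) ^ (numIrred F i / p) := by
  obtain ⟨b, hb⟩ := AddChar.ne_zero_iff.1 hψ
  have hpow : ∀ x : F, ψ x ^ p = 1 := fun x => by
    rw [← AddChar.map_nsmul_eq_pow, nsmul_eq_mul, CharP.cast_eq_zero, zero_mul,
      AddChar.map_zero_eq_one]
  have hζ : IsPrimitiveRoot (ψ (i * b)) p := by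
    have : Fact p.Prime := ⟨hp⟩
    have h1 : orderOf (ψ (i * b)) = p := by
      refine orderOf_eq_prime (hpow _) fun h => hb ?_
      rw [← nsmul_eq_mul, AddChar.map_nsmul_eq_pow] at h
      have hco : Nat.Coprime i p := ((Nat.Prime.coprime_iff_not_dvd hp).2 hi).symm
      have := pow_gcd_eq_one.2 ⟨h, hpow b⟩
      rwa [hco, pow_one] at this
    exact h1 ▸ IsPrimitiveRoot.orderOf _
  have hζ' : IsPrimitiveRoot (PowerSeries.C (ψ (i * b))) p :=
    hζ.map_of_injective (PowerSeries.C_injective)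
  refine eq_of_pow_eq_pow_of_constantCoeff_eq_one hp.ne_zero ?_ ?_ ?_
  · rw [map_prod]
    exact Finset.prod_eq_one fun P _ => by simp [hY]
  · simp [hY, hp.ne_zero]
  · have hinv : ∀ μ ∈ nthRootsFinset p (1 : PowerSeries ℂ),
        ∏ P ∈ irredFinset F i, (1 - μ * (PowerSeries.C (ψ P.nextCoeff) * Y)) =
        ∏ P ∈ irredFinset F i, (1 - PowerSeries.C (ψ P.nextCoeff) * Y) := by
      intro μ hμ
      have : NeZero p := ⟨hp.ne_zero⟩
      -- With `μ = ψ(i b)^k`, translation by `k b` multiplies every `ψ(P₁)` by `μ`.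
      obtain ⟨k, -, rfl⟩ := hζ'.eq_pow_of_pow_eq_one ((mem_nthRootsFinset hp.pos _).1 hμ)
      rw [← prod_irredFinset_taylor (k * b) i fun x => 1 - PowerSeries.C (ψ x) * Y]
      refine Finset.prod_congr rfl fun P _ => ?_
      rw [AddChar.map_add_eq_mul, show (i : F) * (k * b) = k • ((i : F) * b) by
        rw [nsmul_eq_mul]; ring, AddChar.map_nsmul_eq_pow, map_mul PowerSeries.C, map_pow PowerSeries.C]
      ring
    rw [← pow_mul, Nat.div_mul_cancel (dvd_numIrred p hi), ← card_irredFinset,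
      ← hζ'.card_nthRootsFinset, ← Finset.prod_const, ← Finset.prod_congr rfl hinv,
      Finset.prod_comm, ← Finset.prod_const]
    refine Finset.prod_congr rfl fun P _ => ?_
    rw [hζ'.card_nthRootsFinset, ← hζ'.pow_sub_pow_eq_prod_sub_mul _ _ hp.pos, one_pow, mul_pow,
      ← map_pow, hpow, map_one, one_mul]

end Translation

/-! ### The series over all monic polynomials. -/

section TotalSeries

variable {F : Type*} [Field F] [Finite F]

theorem card_monicFinset (m : ℕ) : (monicFinset F m).card = Nat.card F ^ m := by
  rw [monicFinset, ← Set.ncard_eq_toFinset_card _ (finite_monic_natDegree_eq F m),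
    ← Nat.card_coe_set_eq]
  refine (Nat.card_congr ((monicEquivDegreeLT m).trans (degreeLTEquiv F m).toEquiv)).trans ?_
  rw [Nat.card_fun, Nat.card_fin]

theorem monicSeries_one :
    monicSeries (F := F) (fun _ => 1) = PowerSeries.mk fun m => (Nat.card F : ℂ) ^ m := by
  ext m
  simp [monicSeries, card_monicFinset]

/-- In positive degree, adding `b` to `g₁` multiplies the sum by `ψ b ≠ 1`, so the sum is zero. -/
theorem monicSeries_addChar_nextCoeff {ψ : AddChar F ℂ} (hψ : ψ ≠ 0) :
    monicSeries (fun g : F[X] => ψ g.nextCoeff) = 1 := by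
  obtain ⟨b, hb⟩ := AddChar.ne_zero_iff.1 hψ
  ext (_ | m)
  · have : monicFinset F 0 = {1} := by
      ext g
      simp only [mem_monicFinset, Finset.mem_singleton]
      exact ⟨fun h => h.1.natDegree_eq_zero.1 h.2, fun h => by simp [h]⟩
    simp [monicSeries, this, nextCoeff]
  · simp only [monicSeries, PowerSeries.coeff_mk, PowerSeries.coeff_one, Nat.succ_ne_zero,
      if_false]
    have hmem : ∀ (c : F), ∀ g ∈ monicFinset F (m + 1),
        g + C c * X ^ m ∈ monicFinset F (m + 1) := by
      intro c g hg
      obtain ⟨h1, h2⟩ := mem_monicFinset.1 hg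
      have hlt : (C c * X ^ m).degree < g.degree := by
        refine (degree_C_mul_X_pow_le m c).trans_lt ?_
        rw [degree_eq_natDegree h1.ne_zero, h2]
        exact_mod_cast Nat.lt_succ_self m
      exact mem_monicFinset.2 ⟨h1.add_of_left hlt, by rw [natDegree_add_eq_left_of_degree_lt hlt, h2]⟩
    have hS : ∑ g ∈ monicFinset F (m + 1), ψ g.nextCoeff =
        ψ b * ∑ g ∈ monicFinset F (m + 1), ψ g.nextCoeff := by
      rw [Finset.mul_sum]
      symm
      refine Finset.sum_bij (fun g _ => g + C b * X ^ m) (hmem b)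
        (fun _ _ _ _ h => add_right_cancel h) (fun g hg => ⟨g + C (-b) * X ^ m, hmem _ g hg, ?_⟩)
        (fun g hg => ?_)
      · rw [add_assoc, ← add_mul, ← C_add, neg_add_cancel, C_0, zero_mul, add_zero]
      · rw [← AddChar.map_add_eq_mul]
        have h2 := (mem_monicFinset.1 (hmem b g hg)).2
        have h3 := (mem_monicFinset.1 hg).2
        rw [nextCoeff_of_natDegree_pos (by omega), nextCoeff_of_natDegree_pos (by omega), h2, h3]
        simp [add_comm]
    have : (1 - ψ b) * ∑ g ∈ monicFinset F (m + 1), ψ g.nextCoeff = 0 := by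
      linear_combination hS
    rcases mul_eq_zero.1 this with h | h
    · exact absurd (sub_eq_zero.1 h).symm hb
    · exact h

end TotalSeries

/-! ### Expansion of the finite products. -/

section CoefficientExtraction

theorem one_sub_X_pow_pow_eq_sum (d N : ℕ) :
    (1 - PowerSeries.X ^ d : PowerSeries ℂ) ^ N = ∑ j ∈ Finset.range (N + 1),
      PowerSeries.C ((N.choose j : ℂ) * (-1) ^ j) * PowerSeries.X ^ (d * j) := by
  rw [sub_eq_neg_add, add_pow]
  refine Finset.sum_congr rfl fun j _ => ?_
  rw [neg_pow, one_pow, ← pow_mul]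
  simp only [map_mul, map_pow, map_neg, map_one, map_natCast]
  ring

theorem prod_C_mul_X_pow_mul_one_sub_X_pow_pow (T : Finset ℕ) (c : ℕ → ℂ) (b d N : ℕ → ℕ) :
    ∏ i ∈ T, (PowerSeries.C (c i) * PowerSeries.X ^ b i * (1 - PowerSeries.X ^ d i) ^ N i) =
      ∑ j ∈ Fintype.piFinset (fun i : T => Finset.range (N i + 1)),
        PowerSeries.C ((∏ i ∈ T, c i) * ∏ i : T, ((N i).choose (j i) : ℂ) * (-1) ^ j i) *
          PowerSeries.X ^ (∑ i : T, (b i + d i * j i)) := by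
  rw [← Finset.prod_coe_sort]
  simp only [one_sub_X_pow_pow_eq_sum, Finset.mul_sum]
  rw [Finset.prod_univ_sum]
  refine Finset.sum_congr rfl fun j _ => ?_
  rw [← Finset.prod_coe_sort T, ← Finset.prod_mul_distrib, map_prod,
    ← Finset.prod_pow_eq_pow_sum, ← Finset.prod_mul_distrib]
  refine Finset.prod_congr rfl fun i _ => ?_
  rw [pow_add, map_mul PowerSeries.C (c i)]
  ring

end CoefficientExtraction

/-! ### Orthogonality of characters and evaluation of the twisted counts. -/

section CharacterSums

variable {F : Type*} [Field F]

theorem coeffClass_one_eq_iff {g : F[X]} (hg : g.Monic) (α : F) :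
    coeffClass 1 g = coeffClass 1 (X + C α) ↔ g.nextCoeff = α := by
  rw [coeffClass, coeffClass, Ideal.Quotient.eq, Ideal.mem_span_singleton, X_pow_dvd_iff]
  have hα : (X + C α).nextCoeff = α := nextCoeff_X_add_C α
  constructor
  · intro h
    have := h 1 (by norm_num)
    rw [coeff_sub, coeff_one_reverse, coeff_one_reverse, hα] at this
    exact sub_eq_zero.1 this
  · intro h d hd
    interval_cases d
    · rw [coeff_sub, coeff_zero_reverse, coeff_zero_reverse, hg.leadingCoeff,
        (monic_X_add_C α).leadingCoeff, sub_self]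
    · rw [coeff_sub, coeff_one_reverse, coeff_one_reverse, hα, h, sub_self]

variable [Finite F]

open Classical in
/-- The sum of `ψ(g₁)` over the monic polynomials `g = x^m + g₁ x^{m-1} + ⋯` with exactly `l i`
irreducible factors of degree `i` for each `i ∈ T`. -/
noncomputable def twistedCount (ψ : AddChar F ℂ) (m : ℕ) (T : Finset ℕ) (l : ℕ → ℕ) : ℂ :=
  ∑ g ∈ monicFinset F m, if ∀ i ∈ T, numFactors i g = l i then ψ g.nextCoeff else 0

theorem twistedCount_eq_coeff (ψ : AddChar F ℂ) (m : ℕ) (T : Finset ℕ) (l : ℕ → ℕ) :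
    twistedCount ψ m T l = PowerSeries.coeff m ((∏ i ∈ T, (PowerSeries.C
          (PowerSeries.coeff (l i)
            (∏ P ∈ irredFinset F i, PowerSeries.mk fun n => ψ P.nextCoeff ^ n)) *
        PowerSeries.X ^ (i * l i) *
        (∏ P ∈ irredFinset F i, (1 - PowerSeries.C (ψ P.nextCoeff) * PowerSeries.X ^ i)))) *
      monicSeries fun g => ψ g.nextCoeff) := by
  classical
  rw [← monicSeries_forall_sum_multiplicity_eq (irredFinset F) (fun i P hP => mem_irredFinset.1 hP)
    (fun g => ψ g.nextCoeff)
    (fun P h hP hh => by rw [hP.nextCoeff_mul hh, AddChar.map_add_eq_mul])]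
  simp only [monicSeries, PowerSeries.coeff_mk, twistedCount, numFactors_eq_sum]

theorem card_mul_NStar (m : ℕ) (T : Finset ℕ) (l : ℕ → ℕ) (α : F) :
    (Nat.card F : ℂ) * NStar 1 m T l (X + C α) =
      ∑ᶠ ψ : AddChar F ℂ, ψ (-α) * twistedCount ψ m T l := by
  classical
  have := Fintype.ofFinite F
  have hN : NStar 1 m T l (X + C α) = ((monicFinset F m).filter fun g =>
      g.nextCoeff = α ∧ ∀ i ∈ T, numFactors i g = l i).card := by
    rw [NStar, ← Set.ncard_coe_finset]
    congr 1
    ext g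
    simp only [Set.mem_ofPred_eq, Finset.coe_filter, mem_monicFinset, and_assoc]
    refine and_congr_right fun hg => ?_
    rw [coeffClass_one_eq_iff hg]
  rw [hN, Finset.card_filter, finsum_eq_sum_of_fintype]
  simp only [twistedCount, Finset.mul_sum]
  rw [Finset.sum_comm]
  push_cast
  rw [Finset.mul_sum]
  refine Finset.sum_congr rfl fun g _ => ?_
  by_cases h : ∀ i ∈ T, numFactors i g = l i
  · simp only [eq_true h, and_true, if_true]
    rw [Finset.sum_congr rfl fun ψ _ => (AddChar.map_add_eq_mul ψ (-α) g.nextCoeff).symm]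
    rw [AddChar.sum_apply_eq_ite, Nat.card_eq_fintype_card, neg_add_eq_zero]
    simp [eq_comm]
  · simp [h]

/-- A term of exponent `e` meets the coefficient `q^(m-e)` of the geometric series exactly when `e ≤
m`; this is the bracket in `M`. -/
theorem twistedCount_zero (m : ℕ) (T : Finset ℕ) (l : ℕ → ℕ) :
    twistedCount (0 : AddChar F ℂ) m T l = (Nat.card F : ℂ) * (mainTerm F m T l : ℚ) := by
  have hq : (Nat.card F : ℂ) ≠ 0 := Nat.cast_ne_zero.2 Nat.card_pos.ne'
  have hc : ∀ i, PowerSeries.coeff (l i) (∏ P ∈ irredFinset F i,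
      PowerSeries.mk fun n => (0 : AddChar F ℂ) P.nextCoeff ^ n) =
      ((numIrred F i + l i - 1).choose (l i) : ℂ) := fun i => by
    refine coeff_prod_mk_pow_eq _ _ (fun l => ((numIrred F i + l - 1).choose l : ℂ)) ?_ _
    simp only [AddChar.zero_apply, map_one, one_mul, Finset.prod_const, card_irredFinset]
    exact mk_choose_mul_one_sub_X_pow _
  rw [twistedCount_eq_coeff]
  simp only [hc]
  simp only [AddChar.zero_apply, map_one, one_mul, Finset.prod_const, card_irredFinset]
  rw [prod_C_mul_X_pow_mul_one_sub_X_pow_pow T _ (fun i => i * l i) (fun i => i), monicSeries_one,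
    Finset.sum_mul, map_sum, mainTerm]
  push_cast
  rw [Finset.mul_sum, Finset.mul_sum]
  refine Finset.sum_congr rfl fun j _ => ?_
  rw [mul_assoc, PowerSeries.coeff_C_mul, PowerSeries.coeff_X_pow_mul']
  have he : ∑ i : T, (i : ℕ) * (l i + j i) = ∑ i : T, ((i : ℕ) * l i + i * j i) :=
    Finset.sum_congr rfl fun i _ => mul_add _ _ _
  rw [he]
  split_ifs with h
  · push_cast
    rw [PowerSeries.coeff_mk]
    have h1 : ∏ i ∈ T, (Nat.card F : ℂ) ^ (-((i : ℤ) * l i)) =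
        ((Nat.card F : ℂ) ^ ∑ i : T, (i : ℕ) * l i)⁻¹ := by
      rw [← Finset.prod_coe_sort, ← Finset.prod_pow_eq_pow_sum, ← Finset.prod_inv_distrib]
      refine Finset.prod_congr rfl fun i _ => ?_
      rw [zpow_neg]; norm_cast
    have h2 : ∏ i : T, (Nat.card F : ℂ) ^ (-((i : ℤ) * j i)) =
        ((Nat.card F : ℂ) ^ ∑ i : T, (i : ℕ) * j i)⁻¹ := by
      rw [← Finset.prod_pow_eq_pow_sum, ← Finset.prod_inv_distrib]
      refine Finset.prod_congr rfl fun i _ => ?_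
      rw [zpow_neg]; norm_cast
    rw [Finset.prod_mul_distrib (s := T)
      (f := fun i : ℕ => ((numIrred F i + l i - 1).choose (l i) : ℂ)), h1,
      Finset.prod_mul_distrib (s := Finset.univ)
        (f := fun i : T => ((numIrred F i).choose (j i) : ℂ) * (-1) ^ j i), h2, pow_sub₀ _ hq h, zpow_sub_one₀ hq, zpow_natCast, Finset.sum_add_distrib, pow_add]
    field_simp
  · simp

/-- As the full series is `1`, only exponents equal to `m` survive, and no trace of `ψ` remains on
the right. -/
theorem twistedCount_of_ne_zero {p : ℕ} [CharP F p] (hp : p.Prime) {T : Finset ℕ}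
    (hT : ∀ i ∈ T, ¬ p ∣ i) (m : ℕ) (l : ℕ → ℕ) {ψ : AddChar F ℂ} (hψ : ψ ≠ 0) :
    twistedCount ψ m T l =
      ∑ k ∈ Fintype.piFinset (fun i : T => Finset.range (numIrred F i / p + 1)),
        if ∑ i : T, ((i : ℕ) * l i + i * p * k i) = m then
          (∏ i ∈ T, if p ∣ l i then
            ((numIrred F i / p + l i / p - 1).choose (l i / p) : ℂ) else 0) *
          ∏ i : T, ((numIrred F i / p).choose (k i) : ℂ) * (-1) ^ k i
        else 0 := by
  rw [twistedCount_eq_coeff, monicSeries_addChar_nextCoeff hψ, mul_one]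
  rw [Finset.prod_congr rfl (g := fun i => PowerSeries.C (if p ∣ l i then
            ((numIrred F i / p + l i / p - 1).choose (l i / p) : ℂ) else 0) *
            PowerSeries.X ^ (i * l i) * (1 - PowerSeries.X ^ (i * p)) ^ (numIrred F i / p))]
  · rw [prod_C_mul_X_pow_mul_one_sub_X_pow_pow T _ (fun i => i * l i) (fun i => i * p)
      (fun i => numIrred F i / p), map_sum]
    refine Finset.sum_congr rfl fun k _ => ?_
    rw [PowerSeries.coeff_C_mul, PowerSeries.coeff_X_pow]
    simp only [eq_comm (a := m), mul_ite, mul_one, mul_zero]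
  · intro i hi
    have hi0 : i ≠ 0 := by rintro rfl; exact hT 0 hi (dvd_zero p)
    rw [prod_irredFinset_one_sub p hp (hT i hi) hψ (by simp [hi0]), ← pow_mul,
      coeff_prod_mk_pow_eq _ _ (fun l => if p ∣ l then
        ((numIrred F i / p + l / p - 1).choose (l / p) : ℂ) else 0)]
    rw [prod_irredFinset_one_sub p hp (hT i hi) hψ (by simp)]
    exact mk_ite_choose_mul_one_sub_X_pow_pow hp.ne_zero _

theorem card_mul_NStar_eq_add (m : ℕ) (T : Finset ℕ) (l : ℕ → ℕ) (α : F) {D : ℂ}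
    (hD : ∀ ψ : AddChar F ℂ, ψ ≠ 0 → twistedCount ψ m T l = D) :
    (Nat.card F : ℂ) * NStar 1 m T l (X + C α) =
      (Nat.card F : ℂ) * (mainTerm F m T l : ℚ) + (vCoeff α : ℚ) * D := by
  classical
  have := Fintype.ofFinite F
  rw [card_mul_NStar, finsum_eq_sum_of_fintype, ← Finset.add_sum_erase _ _ (Finset.mem_univ 0),
    twistedCount_zero, AddChar.zero_apply, one_mul]
  congr 1
  rw [Finset.sum_congr rfl fun ψ hψ => by rw [hD ψ (Finset.ne_of_mem_erase hψ)],
    ← Finset.sum_mul]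
  congr 1
  -- Orthogonality, minus the trivial character, gives the weight `v(α)`.
  have h := AddChar.sum_apply_eq_ite (-α)
  rw [← Finset.add_sum_erase _ _ (Finset.mem_univ 0), AddChar.zero_apply] at h
  rw [vCoeff, Nat.card_eq_fintype_card]
  simp only [neg_eq_zero] at h
  split_ifs at h ⊢ <;> push_cast <;> linear_combination h

end CharacterSums

theorem corollary7p7 {F : Type*} [Field F] [Finite F] (p : ℕ) (hp : p.Prime) [CharP F p]
    (T : Finset ℕ) (hT : ∀ i ∈ T, ¬ p ∣ i) (m : ℕ) (l : ℕ → ℕ) (α : F) :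
    ((¬ p ∣ m ∨ ∃ i ∈ T, ¬ p ∣ l i) →
      (NStar 1 m T l (X + C α) : ℚ) = mainTerm F m T l) ∧
    ((p ∣ m ∧ ∀ i ∈ T, p ∣ l i) →
      (NStar 1 m T l (X + C α) : ℚ) = mainTerm F m T l + secondTerm p m T l α) := by
  have hq : (Nat.card F : ℂ) ≠ 0 := Nat.cast_ne_zero.2 Nat.card_pos.ne'
  have key := fun ψ : AddChar F ℂ => twistedCount_of_ne_zero (ψ := ψ) hp hT m l
  constructor
  · intro h
    have h0 := card_mul_NStar_eq_add m T l α (D := 0) fun ψ hψ => by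
      rw [key ψ hψ]
      refine Finset.sum_eq_zero fun k _ => ?_
      by_cases hl : ∀ i ∈ T, p ∣ l i
      -- If `p` divides every `l i`, each surviving exponent is a multiple of `p`, which forces `p ∣
      -- m`.
      · rw [if_neg]
        rintro rfl
        rcases h with h | ⟨i, hi, h⟩
        · exact h (Finset.dvd_sum fun i _ => dvd_add (Dvd.dvd.mul_left (hl i i.2) _)
            (Dvd.dvd.mul_right (dvd_mul_left p _) _))
        · exact h (hl i hi)
      · push Not at hl
        obtain ⟨i, hi, hl⟩ := hl
        rw [Finset.prod_eq_zero hi (if_neg hl), zero_mul, ite_self]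
    rw [mul_zero, add_zero] at h0
    exact_mod_cast mul_left_cancel₀ hq h0
  · rintro ⟨hm, hl⟩
    have h0 := card_mul_NStar_eq_add m T l α fun ψ hψ => key ψ hψ
    have h1 : (vCoeff α : ℂ) * ∑ k ∈ Fintype.piFinset
          (fun i : T => Finset.range (numIrred F i / p + 1)),
        (if ∑ i : T, ((i : ℕ) * l i + i * p * k i) = m then
          (∏ i ∈ T, if p ∣ l i then
            ((numIrred F i / p + l i / p - 1).choose (l i / p) : ℂ) else 0) *
          ∏ i : T, ((numIrred F i / p).choose (k i) : ℂ) * (-1) ^ k i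
        else 0) = (Nat.card F : ℂ) * (secondTerm p m T l α : ℚ) := by
      rw [secondTerm]
      push_cast
      rw [div_mul_eq_mul_div, div_mul_eq_mul_div, mul_div_cancel₀ _ hq, mul_assoc]
      congr 1
      rw [Finset.mul_sum]
      refine Finset.sum_congr rfl fun k _ => ?_
      have hc : (∏ i ∈ T, if p ∣ l i then
            ((numIrred F i / p + l i / p - 1).choose (l i / p) : ℂ) else 0) =
          ∏ i ∈ T, ((numIrred F i / p + l i / p - 1).choose (l i / p) : ℂ) :=
        Finset.prod_congr rfl fun i hi => if_pos (hl i hi)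
      rw [hc]
      -- Cancelling `p` turns the exponent condition into the one with `m / p`.
      have hs : ∑ i : T, ((i : ℕ) * l i + i * p * k i) =
          p * ∑ i : T, (i : ℕ) * (l i / p + k i) := by
        rw [Finset.mul_sum]
        refine Finset.sum_congr rfl fun (i : T) _ => ?_
        obtain ⟨c, hc⟩ := hl i i.2
        rw [hc, Nat.mul_div_cancel_left _ hp.pos]
        ring
      obtain ⟨c, rfl⟩ := hm
      rw [hs, Nat.mul_div_cancel_left _ hp.pos]
      simp only [Nat.mul_right_inj hp.ne_zero]
      split_ifs <;> simp
    rw [h1, ← mul_add] at h0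
    exact_mod_cast mul_left_cancel₀ hq h0
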